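/- **Setting.** Fix an integer $K\ge 2$ and constants $A,B,\tau>0$ with $KA\le B<1$ and $\tau\le(1-B)/K$. Let $\mathcal A,\mathcal W$ be measurable spaces. For each $u\in\mathcal A$ let $S_1(u),\dots,S_K(u)$ be similarities of $[0,1]$ into itself with ratios $a(i,u)\ge A$, $\sum_i a(i,u)\le B$, such that $\operatorname{dist}(S_i(u)[0,1],S_j(u)[0,1])\ge\tau$ for $i\ne j$. For each $v\in\mathcal W$ let $(p(1,v),\dots,p(K,v))$ be a probability vector. The functions $a(i,\cdot)$ and $p(i,\cdot)$ are measurable. Let $\mathbb P$ be a probability measure on $\Lambda=\mathcal A\times\mathcal W$ with $\mathbb E(p(i,\lambda)^{-t})<\infty$ for some $t>0$ and all $i$ (with $0^{-t}=\infty$), where for $\lambda=(u,v)$ we write $a(i,\lambda)=a(i,u)$ and $p(i,\lambda)=p(i,v)$. Choose $\boldsymbol\lambda=(\lambda_n)_{n\ge1}\in\Lambda^{\mathbb N}$ according to $\mathbb P^{\mathbb N}$, put $I_{i_1\dots i_n}(\boldsymbol\lambda)=S_{i_1}(\lambda_1)\circ\cdots\circ S_{i_n}(\lambda_n)[0,1]$,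 and let $\mu_{\boldsymbol\lambda}$ be the Borel probability measure on $[0,1]$ with $\mu_{\boldsymbol\lambda}(I_{i_1\dots i_n}(\boldsymbol\lambda))=p(i_1,\lambda_1)\cdots p(i_n,\lambda_n)$ for all $n$ and $i_1,\dots,i_n$. For $\theta\ge0$ let $m(\theta,\lambda)$ (resp. $m'(\theta,\lambda)$) be the smallest index at which $a(j,\lambda)^\theta/p(j,\lambda)$ attains its maximum (resp. minimum) over $j$, and set $$G(\theta)=\frac{\mathbb E\log p(m(\theta,\lambda),\lambda)}{\mathbb E\log a(m(\theta,\lambda),\lambda)},\qquad G'(\theta)=\frac{\mathbb E\log p(m'(\theta,\lambda),\lambda)}{\mathbb E\log a(m'(\theta,\lambda),\lambda)} .$$ A *dimension function* is a map $\Phi:(0,1)\to[0,\infty)$ such that $t^{1+\Phi(t)}$ decreases to $0$ as $t$ decreases to $0$ and $(2t)^{1+\Phi(2t)}\le C\,t^{1+\Phi(t)}$ for some $C>0$ and all small $t>0$; it is *large* if $\Phi(t)=H(t)\,\log|\log t|/|\log t|$ for all small $t$, where $H(t)\to\infty$ as $t\to0$. The upper $\Phi$-dimension $\overline{\dim}_\Phi\mu$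 is the infimum of the $d\in\mathbb R$ for which there are $C_1,C_2>0$ with $\mu(B(x,R))/\mu(B(x,r))\le C_2(R/r)^d$ for all $x\in\operatorname{supp}\mu$ and $0<r<R^{1+\Phi(R)}\le R\le C_1$, $R<1$; the lower $\Phi$-dimension $\underline{\dim}_\Phi\mu$ is the supremum of the $d\in\mathbb R$ for which there are $C_1,C_2>0$ with $\mu(B(x,R))/\mu(B(x,r))\ge C_2(R/r)^d$ for all such $x,r,R$. **Proposition.** There is exactly one $D\ge0$ with $\mathbb E\big(\log\sum_{i=1}^K a(i,\lambda)^D\big)=0$. For this $D$ the following hold. 1. $G(D)\ge D$, and almost surely $\overline{\dim}_\Phi\mu_{\boldsymbol\lambda}\ge D$ for every large dimension function $\Phi$. Moreover $G(D)=D$ if and only if $$p(m(D,\lambda),\lambda)=\frac{a(m(D,\lambda),\lambda)^D}{\sum_{i=1}^K a(i,\lambda)^D}\quad\text{for }\mathbb P\text{-almost every }\lambda .$$ If $G(D)>D$, then almost surely $\overline{\dim}_\Phi\mu_{\boldsymbol\lambda}>D$ for every large dimension function $\Phi$. 2. $G'(D)\le D$, and almost surely $\underline{\dim}_\Phi\mu_{\boldsymbol\lambda}\le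 D$ for every large dimension function $\Phi$. Moreover $G'(D)=D$ if and only if $$p(m'(D,\lambda),\lambda)=\frac{a(m'(D,\lambda),\lambda)^D}{\sum_{i=1}^K a(i,\lambda)^D}\quad\text{for }\mathbb P\text{-almost every }\lambda .$$ If $G'(D)<D$, then almost surely $\underline{\dim}_\Phi\mu_{\boldsymbol\lambda}<D$ for every large dimension function $\Phi$. -/

import Mathlib

open MeasureTheory Filter Topology Set
open scoped unitInterval

noncomputable section

/-! ### Dimension functions and the `Φ`-dimensions of a measure -/

/-- A dimension function `Φ : (0,1) → [0,∞)`: the map `t ↦ t^(1+Φ(t))` decreases to `0` as `t`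
decreases to `0`, and it is doubling near zero.  Only the values of `Φ` on `(0,1)` matter. -/
structure IsDimensionFunction (Φ : ℝ → ℝ) : Prop where
  nonneg : ∀ t ∈ Ioo (0 : ℝ) 1, 0 ≤ Φ t
  monotoneOn : MonotoneOn (fun t : ℝ => t ^ (1 + Φ t)) (Ioo 0 1)
  tendsto_zero : Tendsto (fun t : ℝ => t ^ (1 + Φ t)) (𝓝[>] 0) (𝓝 0)
  doubling : ∃ T C : ℝ, 0 < T ∧ T ≤ 1 / 2 ∧ 0 < C ∧
    ∀ t : ℝ, 0 < t → t < T → (2 * t) ^ (1 + Φ (2 * t)) ≤ C * t ^ (1 + Φ t)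

/-- A large dimension function: `Φ(t) = H(t) log|log t| / |log t|` for small `t`, where
`H(t) → ∞` as `t → 0`. -/
def IsLargeDimensionFunction (Φ : ℝ → ℝ) : Prop :=
  IsDimensionFunction Φ ∧
    ∃ H : ℝ → ℝ, Tendsto H (𝓝[>] 0) atTop ∧
      ∀ᶠ t in 𝓝[>] (0 : ℝ), Φ t = H t * (Real.log |Real.log t| / |Real.log t|)

section PhiDimension

variable {X : Type*} [PseudoMetricSpace X] [MeasurableSpace X]

/-- The condition on the exponent `d` in the definition of the upper `Φ`-dimension of `μ`. -/
def IsUpperPhiExponent (Φ : ℝ → ℝ) (μ : Measure X) (d : ℝ) : Prop :=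
  ∃ C₁ C₂ : ℝ, 0 < C₁ ∧ 0 < C₂ ∧
    ∀ r R : ℝ, 0 < r → 0 < R → R < 1 → r < R ^ (1 + Φ R) → R ^ (1 + Φ R) ≤ R → R ≤ C₁ →
      ∀ x ∈ μ.support,
        μ.real (Metric.ball x R) / μ.real (Metric.ball x r) ≤ C₂ * (R / r) ^ d

/-- The condition on the exponent `d` in the definition of the lower `Φ`-dimension of `μ`. -/
def IsLowerPhiExponent (Φ : ℝ → ℝ) (μ : Measure X) (d : ℝ) : Prop :=
  ∃ C₁ C₂ : ℝ, 0 < C₁ ∧ 0 < C₂ ∧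
    ∀ r R : ℝ, 0 < r → 0 < R → R < 1 → r < R ^ (1 + Φ R) → R ^ (1 + Φ R) ≤ R → R ≤ C₁ →
      ∀ x ∈ μ.support,
        C₂ * (R / r) ^ d ≤ μ.real (Metric.ball x R) / μ.real (Metric.ball x r)

/-- The upper `Φ`-dimension of a measure, as an extended real number (`inf ∅ = ∞`). -/
def upperPhiDim (Φ : ℝ → ℝ) (μ : Measure X) : EReal :=
  sInf ((fun d : ℝ => (d : EReal)) '' {d : ℝ | IsUpperPhiExponent Φ μ d})

/-- The lower `Φ`-dimension of a measure, as an extended real number. -/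
def lowerPhiDim (Φ : ℝ → ℝ) (μ : Measure X) : EReal :=
  sSup ((fun d : ℝ => (d : EReal)) '' {d : ℝ | IsLowerPhiExponent Φ μ d})

end PhiDimension

/-! ### The random Moran model -/

/-- The minimal index in `{1, …, K}` at which `f` attains its maximum. -/
def minArgmax {K : ℕ} (hK : 0 < K) (f : Fin K → ℝ) : Fin K :=
  (Finset.univ.filter fun i => ∀ j, f j ≤ f i).min' (by
    have : Nonempty (Fin K) := ⟨⟨0, hK⟩⟩
    obtain ⟨i, -, hi⟩ := Finset.univ.exists_max_image f Finset.univ_nonempty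
    exact ⟨i, by simpa using hi⟩)

/-- The minimal index in `{1, …, K}` at which `f` attains its minimum. -/
def minArgmin {K : ℕ} (hK : 0 < K) (f : Fin K → ℝ) : Fin K :=
  (Finset.univ.filter fun i => ∀ j, f i ≤ f j).min' (by
    have : Nonempty (Fin K) := ⟨⟨0, hK⟩⟩
    obtain ⟨i, -, hi⟩ := Finset.univ.exists_min_image f Finset.univ_nonempty
    exact ⟨i, by simpa using hi⟩)

/-- The data of the model: for every `u ∈ 𝒜` an iterated function system
`S₁(u), …, S_K(u)` of similarities of `[0,1]` with ratios `a i u`, uniformly separated, and for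
every `v ∈ 𝒲` a probability vector `p · v`. -/
structure MoranModel (K : ℕ) (𝒜 𝒲 : Type*) [MeasurableSpace 𝒜] [MeasurableSpace 𝒲] where
  two_le : 2 ≤ K
  A : ℝ
  B : ℝ
  τ : ℝ
  A_pos : 0 < A
  KA_le_B : K * A ≤ B
  B_lt_one : B < 1
  τ_pos : 0 < τ
  τ_le : τ ≤ (1 - B) / K
  S : Fin K → 𝒜 → I → I
  a : Fin K → 𝒜 → ℝ
  p : Fin K → 𝒲 → ℝ
  dist_S : ∀ i u x y, dist (S i u x) (S i u y) = a i u * dist x y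
  A_le_a : ∀ i u, A ≤ a i u
  sum_a_le : ∀ u, ∑ i, a i u ≤ B
  separated : ∀ u i j, i ≠ j → ∀ x y, τ ≤ dist (S i u x) (S j u y)
  p_nonneg : ∀ i v, 0 ≤ p i v
  sum_p : ∀ v, ∑ i, p i v = 1
  measurable_a : ∀ i, Measurable (a i)
  measurable_p : ∀ i, Measurable (p i)

namespace MoranModel

variable {K : ℕ} {𝒜 𝒲 : Type*} [MeasurableSpace 𝒜] [MeasurableSpace 𝒲] (M : MoranModel K 𝒜 𝒲)

lemma K_pos (M : MoranModel K 𝒜 𝒲) : 0 < K := lt_of_lt_of_le (by norm_num) M.two_le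

lemma a_pos (i : Fin K) (u : 𝒜) : 0 < M.a i u := lt_of_lt_of_le M.A_pos (M.A_le_a i u)

lemma a_le_B (i : Fin K) (u : 𝒜) : M.a i u ≤ M.B :=
  (Finset.single_le_sum (f := fun j => M.a j u) (fun j _ => (M.a_pos j u).le)
    (Finset.mem_univ i)).trans (M.sum_a_le u)

/-- There is `t > 0` with `E(p(i,λ)^(-t)) < ∞` for every `i`, where `0^(-t) = ∞`. -/
def HasNegativeMoment (P : Measure (𝒜 × 𝒲)) : Prop :=
  ∃ t : ℝ, 0 < t ∧ ∀ i, ∫⁻ l, ENNReal.ofReal (M.p i l.2) ^ (-t) ∂P < ⊤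

/-- `S_{i₁}(λ₁) ∘ ⋯ ∘ S_{iₙ}(λₙ)`, where `i_k`, `λ_k` are the terms of index `k - 1` of `ι`, `ω`.
Its range is the Moran interval `I_{i₁,…,iₙ}(ω)`. -/
def comp (ω : ℕ → 𝒜 × 𝒲) (ι : ℕ → Fin K) : ℕ → I → I
  | 0 => id
  | n + 1 => comp ω ι n ∘ M.S (ι n) (ω n).1

/-- The point of the Moran set with address `ι`: the unique common point of the intervals
`I_{i₁,…,iₙ}(ω)`, `n ≥ 0`. -/
def point (ω : ℕ → 𝒜 × 𝒲) (ι : ℕ → Fin K) : I :=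
  limUnder atTop fun n => M.comp ω ι n 0

/-- The probability measure on `{1, …, K}` with weights `p(·, v)`. -/
def weightMeasure (v : 𝒲) : Measure (Fin K) :=
  ∑ i, ENNReal.ofReal (M.p i v) • Measure.dirac i

instance (v : 𝒲) : IsProbabilityMeasure (M.weightMeasure v) := by
  constructor
  simp only [weightMeasure, Measure.coe_finsetSum, Finset.sum_apply, Measure.smul_apply,
    measure_univ, smul_eq_mul, mul_one]
  rw [← ENNReal.ofReal_sum_of_nonneg fun i _ => M.p_nonneg i v, M.sum_p, ENNReal.ofReal_one]

/-- The random measure `μ_ω`: the image under the address map of the product of the weights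
`p(·, ω₁), p(·, ω₂), …`.  By `randomMeasure_range_comp` below it gives the Moran interval
`I_{i₁,…,iₙ}(ω)` the mass `p(i₁,ω₁) ⋯ p(iₙ,ωₙ)`. -/
def randomMeasure (ω : ℕ → 𝒜 × 𝒲) : Measure I :=
  (Measure.infinitePi fun n => M.weightMeasure (ω n).2).map (M.point ω)

/-- `m(θ,λ)`: the minimal index maximizing `a(j,λ)^θ / p(j,λ)`.  (Under `HasNegativeMoment` all
`p(j,λ)` are positive almost surely.) -/
def m (θ : ℝ) (l : 𝒜 × 𝒲) : Fin K :=
  minArgmax M.K_pos fun j => M.a j l.1 ^ θ / M.p j l.2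

/-- `m'(θ,λ)`: the minimal index minimizing `a(j,λ)^θ / p(j,λ)`. -/
def m' (θ : ℝ) (l : 𝒜 × 𝒲) : Fin K :=
  minArgmin M.K_pos fun j => M.a j l.1 ^ θ / M.p j l.2

/-- `G(θ) = E(log p(m(θ,λ),λ)) / E(log a(m(θ,λ),λ))`. -/
def G (P : Measure (𝒜 × 𝒲)) (θ : ℝ) : ℝ :=
  (∫ l, Real.log (M.p (M.m θ l) l.2) ∂P) / ∫ l, Real.log (M.a (M.m θ l) l.1) ∂P

/-- `G'(θ) = E(log p(m'(θ,λ),λ)) / E(log a(m'(θ,λ),λ))`. -/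
def G' (P : Measure (𝒜 × 𝒲)) (θ : ℝ) : ℝ :=
  (∫ l, Real.log (M.p (M.m' θ l) l.2) ∂P) / ∫ l, Real.log (M.a (M.m' θ l) l.1) ∂P

/-- `D ≥ 0` solves `E(log (a(1,λ)^D + ⋯ + a(K,λ)^D)) = 0`, the equation that defines the almost
sure dimension `D` of the Moran set. -/
def IsMoranDimension (P : Measure (𝒜 × 𝒲)) (D : ℝ) : Prop :=
  0 ≤ D ∧ ∫ l, Real.log (∑ i, M.a i l.1 ^ D) ∂P = 0

/-- The natural weight `a(i,λ)^D / (a(1,λ)^D + ⋯ + a(K,λ)^D)`. -/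
def naturalWeight (D : ℝ) (l : 𝒜 × 𝒲) (i : Fin K) : ℝ :=
  M.a i l.1 ^ D / ∑ j, M.a j l.1 ^ D

/-! ### The random measure obeys its defining rule -/

lemma dist_comp (ω : ℕ → 𝒜 × 𝒲) (ι : ℕ → Fin K) (n : ℕ) (x y : I) :
    dist (M.comp ω ι n x) (M.comp ω ι n y) =
      (∏ k ∈ Finset.range n, M.a (ι k) (ω k).1) * dist x y := by
  induction n generalizing x y with
  | zero => simp [comp]
  | succ n ih => simp [comp, ih, M.dist_S, Finset.prod_range_succ, mul_assoc]

lemma prod_a_pos (ω : ℕ → 𝒜 × 𝒲) (ι : ℕ → Fin K) (n : ℕ) :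
    0 < ∏ k ∈ Finset.range n, M.a (ι k) (ω k).1 :=
  Finset.prod_pos fun _ _ => M.a_pos _ _

lemma prod_a_le (ω : ℕ → 𝒜 × 𝒲) (ι : ℕ → Fin K) (n : ℕ) :
    ∏ k ∈ Finset.range n, M.a (ι k) (ω k).1 ≤ M.B ^ n := by
  simpa using Finset.prod_le_prod (s := Finset.range n)
    (fun k _ => (M.a_pos (ι k) (ω k).1).le) (fun k _ => M.a_le_B (ι k) (ω k).1)

lemma B_pos : 0 < M.B :=
  lt_of_lt_of_le (mul_pos (Nat.cast_pos.2 M.K_pos) M.A_pos) M.KA_le_B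

lemma comp_injective (ω : ℕ → 𝒜 × 𝒲) (ι : ℕ → Fin K) (n : ℕ) :
    Function.Injective (M.comp ω ι n) := by
  intro x y h
  have := M.dist_comp ω ι n x y
  rw [h, dist_self] at this
  exact dist_eq_zero.1 ((mul_eq_zero.1 this.symm).resolve_left (M.prod_a_pos ω ι n).ne')

lemma continuous_comp (ω : ℕ → 𝒜 × 𝒲) (ι : ℕ → Fin K) (n : ℕ) :
    Continuous (M.comp ω ι n) :=
  (LipschitzWith.of_dist_le_mul
    (K := ⟨∏ k ∈ Finset.range n, M.a (ι k) (ω k).1, (M.prod_a_pos ω ι n).le⟩)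
    fun x y => (M.dist_comp ω ι n x y).le).continuous

lemma comp_congr (ω : ℕ → 𝒜 × 𝒲) {ι κ : ℕ → Fin K} {n : ℕ} (h : ∀ k < n, κ k = ι k) :
    M.comp ω κ n = M.comp ω ι n := by
  induction n with
  | zero => rfl
  | succ n ih =>
    simp only [comp]
    rw [ih fun k hk => h k (hk.trans n.lt_succ_self), h n n.lt_succ_self]

lemma dist_le_one (x y : I) : dist x y ≤ 1 := by
  rw [Subtype.dist_eq, Real.dist_eq, abs_le]
  have := x.2.1; have := x.2.2; have := y.2.1; have := y.2.2
  constructor <;> linarith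

lemma tendsto_point (ω : ℕ → 𝒜 × 𝒲) (ι : ℕ → Fin K) :
    Tendsto (fun n => M.comp ω ι n 0) atTop (𝓝 (M.point ω ι)) := by
  refine CauchySeq.tendsto_limUnder (cauchySeq_of_le_geometric M.B 1 M.B_lt_one fun n => ?_)
  rw [comp, Function.comp_apply, M.dist_comp, one_mul]
  exact (mul_le_of_le_one_right (M.prod_a_pos ω ι n).le (dist_le_one _ _)).trans
    (M.prod_a_le ω ι n)

lemma range_comp_anti (ω : ℕ → 𝒜 × 𝒲) (ι : ℕ → Fin K) :
    Antitone fun n => range (M.comp ω ι n) :=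
  antitone_nat_of_succ_le fun n => by
    rintro _ ⟨x, rfl⟩
    exact ⟨M.S (ι n) (ω n).1 x, rfl⟩

lemma point_mem_range (ω : ℕ → 𝒜 × 𝒲) (ι : ℕ → Fin K) (n : ℕ) :
    M.point ω ι ∈ range (M.comp ω ι n) := by
  refine (isCompact_range (M.continuous_comp ω ι n)).isClosed.mem_of_tendsto
    (M.tendsto_point ω ι) ?_
  filter_upwards [eventually_ge_atTop n] with k hk
  exact M.range_comp_anti ω ι hk ⟨0, rfl⟩

lemma point_mem_range_iff (ω : ℕ → 𝒜 × 𝒲) (ι κ : ℕ → Fin K) (n : ℕ) :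
    M.point ω κ ∈ range (M.comp ω ι n) ↔ ∀ k < n, κ k = ι k := by
  constructor
  · intro h k hk
    induction k using Nat.strong_induction_on with
    | _ k ih =>
      by_contra hne
      obtain ⟨x, hx⟩ := M.range_comp_anti ω ι (Nat.succ_le_of_lt hk) h
      obtain ⟨y, hy⟩ := M.point_mem_range ω κ (k + 1)
      rw [comp, M.comp_congr ω fun j hj => ih j hj (hj.trans hk), ← hx, comp] at hy
      have h1 := M.comp_injective ω ι k hy
      have h2 := M.separated (ω k).1 _ _ hne y x
      rw [h1, dist_self] at h2
      exact absurd h2 (not_le.2 M.τ_pos)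
  · intro h
    rw [← M.comp_congr ω h]
    exact M.point_mem_range ω κ n

lemma continuous_point (ω : ℕ → 𝒜 × 𝒲) : Continuous (M.point ω) := by
  rw [continuous_iff_continuousAt]
  intro ι
  rw [ContinuousAt, Metric.tendsto_nhds]
  intro ε hε
  obtain ⟨n, hn⟩ := exists_pow_lt_of_lt_one hε M.B_lt_one
  have hU : {κ : ℕ → Fin K | ∀ k ∈ Finset.range n, κ k = ι k} ∈ 𝓝 ι := by
    have : ∀ᶠ κ in 𝓝 ι, ∀ k ∈ Finset.range n, κ k = ι k := by
      rw [Filter.eventually_all_finset]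
      intro k _
      exact (continuous_apply k).continuousAt.eventually
        (f := fun κ : ℕ → Fin K => κ k) (p := fun z => z = ι k)
        (by rw [nhds_discrete]; simp)
    exact this
  filter_upwards [hU] with κ hκ
  obtain ⟨x, hx⟩ := (M.point_mem_range_iff ω ι κ n).2 fun k hk => hκ k (Finset.mem_range.2 hk)
  obtain ⟨y, hy⟩ := M.point_mem_range ω ι n
  rw [← hx, ← hy, M.dist_comp]
  exact ((mul_le_of_le_one_right (M.prod_a_pos ω ι n).le (dist_le_one _ _)).trans
    (M.prod_a_le ω ι n)).trans_lt hn

lemma weightMeasure_singleton (v : 𝒲) (i : Fin K) :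
    M.weightMeasure v {i} = ENNReal.ofReal (M.p i v) := by
  simp only [weightMeasure, Measure.coe_finsetSum, Finset.sum_apply, Measure.smul_apply,
    smul_eq_mul]
  rw [Finset.sum_eq_single i]
  · simp
  · intro j _ hj
    simp [hj]
  · simp

instance (ω : ℕ → 𝒜 × 𝒲) : IsProbabilityMeasure (M.randomMeasure ω) :=
  Measure.isProbabilityMeasure_map (M.continuous_point ω).measurable.aemeasurable

/-- `μ_ω(I_{i₁,…,iₙ}(ω)) = p(i₁,ω₁) ⋯ p(iₙ,ωₙ)`. -/
theorem randomMeasure_range_comp (ω : ℕ → 𝒜 × 𝒲) (ι : ℕ → Fin K) (n : ℕ) :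
    M.randomMeasure ω (range (M.comp ω ι n)) =
      ∏ k ∈ Finset.range n, ENNReal.ofReal (M.p (ι k) (ω k).2) := by
  rw [randomMeasure, Measure.map_apply (M.continuous_point ω).measurable
    (isCompact_range (M.continuous_comp ω ι n)).isClosed.measurableSet]
  have : M.point ω ⁻¹' range (M.comp ω ι n) =
      Set.pi (Finset.range n : Set ℕ) fun k => {ι k} := by
    ext κ
    simp [M.point_mem_range_iff]
  rw [this, Measure.infinitePi_pi _ fun _ _ => MeasurableSet.singleton _]
  exact Finset.prod_congr rfl fun k _ => M.weightMeasure_singleton _ _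

end MoranModel

end

/-!
Both conclusions about `Φ`-dimensions come from one point.  In the definition of the
`Φ`-dimensions the outer radius `R` may be kept fixed while the inner radius `r` tends to `0`, so
the upper `Φ`-dimension of a measure is at least, and the lower one at most, its local dimension
at any point of the support where that exists.  For a measurable selector `s : 𝒜 × 𝒲 → Fin K`
take the point whose address is `s (ω₁), s (ω₂), …`.  By the separation of the Moran intervals a
ball around it whose radius is comparable to `a (s ω₁) ⋯ a (s ωₙ)` has mass comparable to
`p (s ω₁) ⋯ p (s ωₙ)`, and the strong law of large numbers shows that almost surely the local
dimension there is `E (log p (s)) / E (log a (s))` (`MoranModel.ae_ratio_le_upperPhiDim_and`).  With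
`s = m(D, ·)` and `s = m'(D, ·)` this ratio is `G(D)` and `G'(D)`.

Next, `G(D)` and `D` are compared through the natural weights `q i = a i ^ D / ∑ j, a j ^ D`.
As `E (log ∑ j, a j ^ D) = 0`, the difference of `E (log p (s))` and `D * E (log a (s))` is
`E (log p (s) - log q (s))`.  Since `p` and `q` both have sum `1`, the index maximizing `q / p` has
`p ≤ q` and the index minimizing it has `q ≤ p`.  This gives the inequalities between `G(D)`,
`G'(D)` and `D`, with equality exactly when `p = q` almost surely at the selected index.

Finally `E (log ∑ j, a j ^ D)` is continuous and strictly decreasing in `D`, equals `log K`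
at `0` and negative at `1`, and so has exactly one zero.
-/

open ProbabilityTheory

/-! ### Selecting a maximizing or minimizing index -/

lemma le_minArgmax {K : ℕ} (hK : 0 < K) (f : Fin K → ℝ) (j : Fin K) :
    f j ≤ f (minArgmax hK f) :=
  (Finset.mem_filter.1 (Finset.min'_mem (Finset.univ.filter fun i => ∀ j, f j ≤ f i) _)).2 j

lemma minArgmin_eq_minArgmax_neg {K : ℕ} (hK : 0 < K) (f : Fin K → ℝ) :
    minArgmin hK f = minArgmax hK fun i => -f i := by
  simp only [minArgmin, minArgmax, neg_le_neg_iff]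

lemma minArgmin_le {K : ℕ} (hK : 0 < K) (f : Fin K → ℝ) (j : Fin K) :
    f (minArgmin hK f) ≤ f j := by
  rw [minArgmin_eq_minArgmax_neg]
  exact neg_le_neg_iff.1 (le_minArgmax hK (fun i => -f i) j)

lemma measurable_minArgmax {Ω : Type*} [MeasurableSpace Ω] {K : ℕ} (hK : 0 < K)
    {f : Fin K → Ω → ℝ} (hf : ∀ i, Measurable (f i)) :
    Measurable fun x => minArgmax hK fun i => f i x := by
  refine measurable_to_countable' fun i => ?_
  have : (fun x => minArgmax hK fun i => f i x) ⁻¹' {i} =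
      {x | (∀ j, f j x ≤ f i x) ∧ ∀ b, (∀ j, f j x ≤ f b x) → i ≤ b} := by
    ext x
    simp [minArgmax, Finset.min'_eq_iff]
  have hS : ∀ b, MeasurableSet {x | ∀ j, f j x ≤ f b x} := fun b => by
    rw [ofPred_forall]
    exact MeasurableSet.iInter fun j => measurableSet_le (hf j) (hf b)
  rw [this]
  have hI : MeasurableSet {x | ∀ b, (∀ j, f j x ≤ f b x) → i ≤ b} := by
    rw [ofPred_forall]
    exact MeasurableSet.iInter fun b => (hS b).imp (MeasurableSet.const _)
  exact (hS i).inter hI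

/-- Two weight vectors with the same sum: where `q / p` is largest, `p ≤ q`. -/
lemma le_of_forall_div_le_div {K : ℕ} {p q : Fin K → ℝ} (hp : ∀ i, 0 < p i)
    (hsum : ∑ i, p i = ∑ i, q i) {m : Fin K} (hm : ∀ j, q j / p j ≤ q m / p m) :
    p m ≤ q m := by
  by_contra! h
  refine (Finset.sum_lt_sum_of_nonempty ⟨m, Finset.mem_univ m⟩ fun j _ => ?_).ne' hsum
  have h1 := (hm j).trans_lt ((div_lt_one (hp m)).2 h)
  exact (div_lt_one (hp j)).1 h1

/-- Two weight vectors with the same sum: where `q / p` is smallest, `q ≤ p`. -/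
lemma le_of_forall_div_ge_div {K : ℕ} {p q : Fin K → ℝ} (hp : ∀ i, 0 < p i)
    (hsum : ∑ i, p i = ∑ i, q i) {m : Fin K} (hm : ∀ j, q m / p m ≤ q j / p j) :
    q m ≤ p m := by
  by_contra! h
  refine (Finset.sum_lt_sum_of_nonempty ⟨m, Finset.mem_univ m⟩ fun j _ => ?_).ne hsum
  have h1 := ((one_lt_div (hp m)).2 h).trans_le (hm j)
  exact (one_lt_div (hp j)).1 h1

/-- The strong law of large numbers for a function of the coordinates of an i.i.d. sequence. -/
lemma ae_tendsto_average_infinitePi {Ω : Type*} [MeasurableSpace Ω] (P : Measure Ω)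
    [IsProbabilityMeasure P] {f : Ω → ℝ} (hf : Measurable f) (hint : Integrable f P) :
    ∀ᵐ ω ∂(Measure.infinitePi fun _ : ℕ => P),
      Tendsto (fun n : ℕ => (∑ k ∈ Finset.range n, f (ω k)) / n) atTop (𝓝 (∫ x, f x ∂P)) := by
  have hmp := fun k : ℕ => measurePreserving_eval_infinitePi (fun _ : ℕ => P) k
  have h0 : ∫ ω, f (ω 0) ∂(Measure.infinitePi fun _ : ℕ => P) = ∫ x, f x ∂P := by
    have hf' : AEStronglyMeasurable f
        ((Measure.infinitePi fun _ : ℕ => P).map (Function.eval 0)) := hf.aestronglyMeasurable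
    have h := integral_map (hmp 0).measurable.aemeasurable hf'
    rw [(hmp 0).map_eq] at h
    exact h.symm
  rw [← h0]
  refine strong_law_ae_real (fun (k : ℕ) (ω : ℕ → Ω) => f (ω k)) ?_ ?_ ?_
  · exact (hmp 0).integrable_comp_of_integrable hint
  · intro i j hij
    exact (iIndepFun_infinitePi (P := fun _ : ℕ => P) (X := fun _ => f)
      fun _ => hf).indepFun hij
  · intro k
    have hk : IdentDistrib (Function.eval k) (Function.eval 0)
        (Measure.infinitePi fun _ : ℕ => P) (Measure.infinitePi fun _ : ℕ => P) :=
      ⟨(hmp k).measurable.aemeasurable, (hmp 0).measurable.aemeasurable, by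
        rw [(hmp k).map_eq, (hmp 0).map_eq]⟩
    exact hk.comp hf

lemma le_of_tendsto_average {u v : ℕ → ℝ} {U V c : ℝ}
    (hu : Tendsto (fun n : ℕ => u n / n) atTop (𝓝 U))
    (hv : Tendsto (fun n : ℕ => v n / n) atTop (𝓝 V)) (h : ∀ᶠ n in atTop, c + u n ≤ v n) :
    U ≤ V := by
  have h1 : Tendsto (fun n : ℕ => c / n + u n / n) atTop (𝓝 (0 + U)) :=
    (tendsto_const_div_atTop_nhds_zero_nat c).add hu
  rw [zero_add] at h1
  refine le_of_tendsto_of_tendsto h1 hv ?_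
  filter_upwards [h] with n hn
  rw [← add_div]
  exact div_le_div_of_nonneg_right hn n.cast_nonneg

namespace MoranModel

variable {K : ℕ} {𝒜 𝒲 : Type*} [MeasurableSpace 𝒜] [MeasurableSpace 𝒲] (M : MoranModel K 𝒜 𝒲)

/-! ### Masses of balls around a point of the Moran set -/

lemma randomMeasure_real_range_comp (ω : ℕ → 𝒜 × 𝒲) (ι : ℕ → Fin K) (n : ℕ) :
    (M.randomMeasure ω).real (range (M.comp ω ι n)) =
      ∏ k ∈ Finset.range n, M.p (ι k) (ω k).2 := by
  rw [measureReal_def, randomMeasure_range_comp, ENNReal.toReal_prod]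
  exact Finset.prod_congr rfl fun k _ => ENNReal.toReal_ofReal (M.p_nonneg _ _)

lemma prod_a_anti (ω : ℕ → 𝒜 × 𝒲) (ι : ℕ → Fin K) :
    Antitone fun n => ∏ k ∈ Finset.range n, M.a (ι k) (ω k).1 :=
  antitone_nat_of_succ_le fun n => by
    rw [Finset.prod_range_succ]
    exact mul_le_of_le_one_right (M.prod_a_pos ω ι n).le
      ((M.a_le_B _ _).trans M.B_lt_one.le)

lemma tendsto_prod_a (ω : ℕ → 𝒜 × 𝒲) (ι : ℕ → Fin K) :
    Tendsto (fun n => ∏ k ∈ Finset.range n, M.a (ι k) (ω k).1) atTop (𝓝 0) :=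
  squeeze_zero (fun n => (M.prod_a_pos ω ι n).le) (fun n => M.prod_a_le ω ι n)
    (tendsto_pow_atTop_nhds_zero_of_lt_one M.B_pos.le M.B_lt_one)

/-- Points whose addresses differ before level `n` are separated at the scale of level `n`. -/
lemma eq_of_dist_point_lt {ω : ℕ → 𝒜 × 𝒲} {ι κ : ℕ → Fin K} {n : ℕ}
    (h : dist (M.point ω κ) (M.point ω ι) < M.τ * ∏ k ∈ Finset.range n, M.a (ι k) (ω k).1) :
    ∀ k < n, κ k = ι k := by
  intro k hk
  induction k using Nat.strong_induction_on with
  | _ k ih =>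
    by_contra hne
    obtain ⟨x, hx⟩ := M.point_mem_range ω κ (k + 1)
    obtain ⟨y, hy⟩ := M.point_mem_range ω ι (k + 1)
    rw [comp, M.comp_congr ω fun j hj => ih j hj (hj.trans hk)] at hx
    rw [comp] at hy
    rw [← hx, ← hy, Function.comp_apply, Function.comp_apply, M.dist_comp, mul_comm M.τ] at h
    refine absurd h (not_lt.2 ?_)
    exact mul_le_mul (M.prod_a_anti ω ι hk.le) (M.separated _ _ _ hne x y) M.τ_pos.le
      (M.prod_a_pos ω ι k).le

lemma randomMeasure_real_ball_le (ω : ℕ → 𝒜 × 𝒲) (ι : ℕ → Fin K) (n : ℕ) :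
    (M.randomMeasure ω).real
        (Metric.ball (M.point ω ι) (M.τ * ∏ k ∈ Finset.range n, M.a (ι k) (ω k).1)) ≤
      ∏ k ∈ Finset.range n, M.p (ι k) (ω k).2 := by
  rw [← randomMeasure_real_range_comp]
  refine ENNReal.toReal_mono (measure_ne_top _ _) ?_
  rw [randomMeasure, Measure.map_apply (M.continuous_point ω).measurable
    Metric.isOpen_ball.measurableSet, Measure.map_apply (M.continuous_point ω).measurable
    (isCompact_range (M.continuous_comp ω ι n)).isClosed.measurableSet]
  exact measure_mono fun κ hκ =>
    (M.point_mem_range_iff ω ι κ n).2 (M.eq_of_dist_point_lt hκ)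

lemma le_randomMeasure_real_ball {ω : ℕ → 𝒜 × 𝒲} {ι : ℕ → Fin K} {n : ℕ} {r : ℝ}
    (hr : ∏ k ∈ Finset.range n, M.a (ι k) (ω k).1 < r) :
    ∏ k ∈ Finset.range n, M.p (ι k) (ω k).2 ≤
      (M.randomMeasure ω).real (Metric.ball (M.point ω ι) r) := by
  rw [← randomMeasure_real_range_comp]
  refine measureReal_mono ?_
  rintro _ ⟨x, rfl⟩
  obtain ⟨y, hy⟩ := M.point_mem_range ω ι n
  rw [Metric.mem_ball, ← hy, M.dist_comp]
  exact (mul_le_of_le_one_right (M.prod_a_pos ω ι n).le (dist_le_one _ _)).trans_lt hr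

lemma randomMeasure_real_ball_pos {ω : ℕ → 𝒜 × 𝒲} {ι : ℕ → Fin K}
    (hp : ∀ k, 0 < M.p (ι k) (ω k).2) {r : ℝ} (hr : 0 < r) :
    0 < (M.randomMeasure ω).real (Metric.ball (M.point ω ι) r) := by
  obtain ⟨n, hn⟩ := ((M.tendsto_prod_a ω ι).eventually_lt_const hr).exists
  exact (Finset.prod_pos fun k _ => hp k).trans_le (M.le_randomMeasure_real_ball hn)

lemma point_mem_support {ω : ℕ → 𝒜 × 𝒲} {ι : ℕ → Fin K}
    (hp : ∀ k, 0 < M.p (ι k) (ω k).2) : M.point ω ι ∈ (M.randomMeasure ω).support := by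
  rw [Measure.support_eq_forall_isOpen]
  intro U hxU hU
  obtain ⟨r, hr, hrU⟩ := Metric.isOpen_iff.1 hU _ hxU
  refine lt_of_lt_of_le ?_ (measure_mono hrU)
  exact (ENNReal.toReal_pos_iff.1 (M.randomMeasure_real_ball_pos hp hr)).1

/-! ### Local dimensions bound the `Φ`-dimensions -/

/-- A fixed outer radius for which all sufficiently small inner radii `r < R ^ (1 + Φ R)` are
admissible in the definition of the `Φ`-dimensions. -/
lemma exists_outer_radius {Φ : ℝ → ℝ} (hΦ : IsDimensionFunction Φ) {C : ℝ} (hC : 0 < C) :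
    ∃ R : ℝ, 0 < R ∧ R < 1 ∧ R ≤ C ∧ R ^ (1 + Φ R) ≤ R ∧ 0 < R ^ (1 + Φ R) := by
  have h0 : 0 < min C (1 / 2) := lt_min hC (by norm_num)
  have h1 : min C (1 / 2) < 1 := (min_le_right _ _).trans_lt (by norm_num)
  refine ⟨_, h0, h1, min_le_left _ _, ?_, Real.rpow_pos_of_pos h0 _⟩
  conv_rhs => rw [← Real.rpow_one (min C (1 / 2))]
  exact Real.rpow_le_rpow_of_exponent_ge h0 h1.le (by linarith [hΦ.nonneg _ ⟨h0, h1⟩])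

lemma log_const_mul_prod_a (ω : ℕ → 𝒜 × 𝒲) (ι : ℕ → Fin K) (n : ℕ) {c : ℝ} (hc : 0 < c) :
    Real.log (c * ∏ k ∈ Finset.range n, M.a (ι k) (ω k).1) =
      Real.log c + ∑ k ∈ Finset.range n, Real.log (M.a (ι k) (ω k).1) := by
  rw [Real.log_mul hc.ne' (M.prod_a_pos ω ι n).ne', Real.log_prod fun k _ => (M.a_pos _ _).ne']

lemma ratio_le_of_isUpperPhiExponent {ω : ℕ → 𝒜 × 𝒲} {ι : ℕ → Fin K}
    (hp : ∀ k, 0 < M.p (ι k) (ω k).2) {u v : ℝ} (hv : v < 0)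
    (hlogp : Tendsto (fun n : ℕ => (∑ k ∈ Finset.range n, Real.log (M.p (ι k) (ω k).2)) / n)
      atTop (𝓝 u))
    (hloga : Tendsto (fun n : ℕ => (∑ k ∈ Finset.range n, Real.log (M.a (ι k) (ω k).1)) / n)
      atTop (𝓝 v))
    {Φ : ℝ → ℝ} (hΦ : IsDimensionFunction Φ) {d : ℝ}
    (hd : IsUpperPhiExponent Φ (M.randomMeasure ω) d) : u / v ≤ d := by
  obtain ⟨C₁, C₂, hC₁, hC₂, h⟩ := hd
  obtain ⟨R, hR0, hR1, hRC, hRΦ, hpos⟩ := exists_outer_radius hΦ hC₁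
  set mR := (M.randomMeasure ω).real (Metric.ball (M.point ω ι) R) with hmR
  have hmR0 : 0 < mR := M.randomMeasure_real_ball_pos hp hR0
  have hsmall : ∀ᶠ n in atTop,
      M.τ * ∏ k ∈ Finset.range n, M.a (ι k) (ω k).1 < R ^ (1 + Φ R) := by
    have := (M.tendsto_prod_a ω ι).const_mul M.τ
    rw [mul_zero] at this
    exact this.eventually_lt_const hpos
  have hle : d * v ≤ u := by
    have hda := hloga.const_mul d
    simp only [← mul_div_assoc] at hda
    refine le_of_tendsto_average (c := Real.log mR - Real.log C₂ - d * Real.log R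
      + d * Real.log M.τ) hda hlogp ?_
    filter_upwards [hsmall] with n hn
    have hr0 := mul_pos M.τ_pos (M.prod_a_pos ω ι n)
    have hQ : 0 < ∏ k ∈ Finset.range n, M.p (ι k) (ω k).2 := Finset.prod_pos fun k _ => hp k
    have h1 := (div_le_div_of_nonneg_left hmR0.le (M.randomMeasure_real_ball_pos hp hr0)
      (M.randomMeasure_real_ball_le ω ι n)).trans
      (h _ R hr0 hR0 hR1 hn hRΦ hRC _ (M.point_mem_support hp))
    have h2 := Real.log_le_log (div_pos hmR0 hQ) h1
    rw [Real.log_div hmR0.ne' hQ.ne', Real.log_prod fun k _ => (hp k).ne',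
      Real.log_mul hC₂.ne' (Real.rpow_pos_of_pos (div_pos hR0 hr0) d).ne',
      Real.log_rpow (div_pos hR0 hr0), Real.log_div hR0.ne' hr0.ne',
      M.log_const_mul_prod_a ω ι n M.τ_pos] at h2
    linarith
  rwa [div_le_iff_of_neg hv]

lemma le_ratio_of_isLowerPhiExponent {ω : ℕ → 𝒜 × 𝒲} {ι : ℕ → Fin K}
    (hp : ∀ k, 0 < M.p (ι k) (ω k).2) {u v : ℝ} (hv : v < 0)
    (hlogp : Tendsto (fun n : ℕ => (∑ k ∈ Finset.range n, Real.log (M.p (ι k) (ω k).2)) / n)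
      atTop (𝓝 u))
    (hloga : Tendsto (fun n : ℕ => (∑ k ∈ Finset.range n, Real.log (M.a (ι k) (ω k).1)) / n)
      atTop (𝓝 v))
    {Φ : ℝ → ℝ} (hΦ : IsDimensionFunction Φ) {d : ℝ}
    (hd : IsLowerPhiExponent Φ (M.randomMeasure ω) d) : d ≤ u / v := by
  obtain ⟨C₁, C₂, hC₁, hC₂, h⟩ := hd
  obtain ⟨R, hR0, hR1, hRC, hRΦ, hpos⟩ := exists_outer_radius hΦ hC₁
  have hsmall : ∀ᶠ n in atTop,
      2 * ∏ k ∈ Finset.range n, M.a (ι k) (ω k).1 < R ^ (1 + Φ R) := by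
    have := (M.tendsto_prod_a ω ι).const_mul 2
    rw [mul_zero] at this
    exact this.eventually_lt_const hpos
  have hle : u ≤ d * v := by
    have hda := hloga.const_mul d
    simp only [← mul_div_assoc] at hda
    refine le_of_tendsto_average (c := Real.log C₂ + d * Real.log R - d * Real.log 2)
      hlogp hda ?_
    filter_upwards [hsmall] with n hn
    have ha := M.prod_a_pos ω ι n
    have hr0 := mul_pos two_pos ha
    have hQ : 0 < ∏ k ∈ Finset.range n, M.p (ι k) (ω k).2 := Finset.prod_pos fun k _ => hp k
    have h1 := (h _ R hr0 hR0 hR1 hn hRΦ hRC _ (M.point_mem_support hp)).trans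
      (div_le_div₀ zero_le_one measureReal_le_one hQ
        (M.le_randomMeasure_real_ball (lt_two_mul_self ha)))
    have h2 := Real.log_le_log
      (mul_pos hC₂ (Real.rpow_pos_of_pos (div_pos hR0 hr0) d)) h1
    rw [Real.log_div one_ne_zero hQ.ne', Real.log_one, Real.log_prod fun k _ => (hp k).ne',
      Real.log_mul hC₂.ne' (Real.rpow_pos_of_pos (div_pos hR0 hr0) d).ne',
      Real.log_rpow (div_pos hR0 hr0), Real.log_div hR0.ne' hr0.ne',
      M.log_const_mul_prod_a ω ι n two_pos] at h2
    linarith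
  rwa [le_div_iff_of_neg hv]

/-! ### Integrability of the logarithms -/

lemma p_le_one (i : Fin K) (v : 𝒲) : M.p i v ≤ 1 :=
  (Finset.single_le_sum (f := fun j => M.p j v) (fun j _ => M.p_nonneg j v)
    (Finset.mem_univ i)).trans_eq (M.sum_p v)

lemma ae_p_pos {P : Measure (𝒜 × 𝒲)} (hP : M.HasNegativeMoment P) :
    ∀ᵐ l ∂P, ∀ i, 0 < M.p i l.2 := by
  obtain ⟨t, ht, h⟩ := hP
  rw [ae_all_iff]
  intro i
  have hm : Measurable fun l : 𝒜 × 𝒲 => ENNReal.ofReal (M.p i l.2) ^ (-t) :=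
    ((M.measurable_p i).comp measurable_snd).ennreal_ofReal.pow_const _
  filter_upwards [ae_lt_top hm (h i).ne] with l hl
  by_contra h0
  rw [ENNReal.ofReal_of_nonpos (not_lt.1 h0), ENNReal.zero_rpow_of_neg (neg_lt_zero.2 ht)] at hl
  exact lt_irrefl _ hl

lemma integrable_log_p {P : Measure (𝒜 × 𝒲)} (hP : M.HasNegativeMoment P) (i : Fin K) :
    Integrable (fun l => Real.log (M.p i l.2)) P := by
  have hpos := M.ae_p_pos hP
  obtain ⟨t, ht, h⟩ := hP
  have hmp : Measurable fun l : 𝒜 × 𝒲 => M.p i l.2 := (M.measurable_p i).comp measurable_snd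
  have h1 := (integrable_toReal_of_lintegral_ne_top
    (hmp.ennreal_ofReal.pow_const (-t)).aemeasurable (h i).ne).div_const t
  refine h1.mono' (Real.measurable_log.comp hmp).aestronglyMeasurable ?_
  filter_upwards [hpos] with l hl
  -- `-log p = log p⁻¹ ≤ p ^ (-t) / t`
  rw [← ENNReal.toReal_rpow, ENNReal.toReal_ofReal (M.p_nonneg _ _), Real.norm_eq_abs,
    abs_of_nonpos (Real.log_nonpos (M.p_nonneg _ _) (M.p_le_one _ _)), ← Real.log_inv,
    Real.rpow_neg (M.p_nonneg _ _), ← Real.inv_rpow (M.p_nonneg _ _)]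
  exact Real.log_le_rpow_div (inv_nonneg.2 (M.p_nonneg _ _)) ht

lemma measurable_p_selector {s : 𝒜 × 𝒲 → Fin K} (hs : Measurable s) :
    Measurable fun l => M.p (s l) l.2 :=
  (measurable_from_prod_countable_right (f := fun x : Fin K × (𝒜 × 𝒲) => M.p x.1 x.2.2)
    fun i => (M.measurable_p i).comp measurable_snd).comp (hs.prodMk measurable_id)

lemma measurable_a_selector {s : 𝒜 × 𝒲 → Fin K} (hs : Measurable s) :
    Measurable fun l => M.a (s l) l.1 :=
  (measurable_from_prod_countable_right (f := fun x : Fin K × (𝒜 × 𝒲) => M.a x.1 x.2.1)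
    fun i => (M.measurable_a i).comp measurable_fst).comp (hs.prodMk measurable_id)

lemma integrable_log_p_selector {P : Measure (𝒜 × 𝒲)} (hP : M.HasNegativeMoment P)
    {s : 𝒜 × 𝒲 → Fin K} (hs : Measurable s) :
    Integrable (fun l => Real.log (M.p (s l) l.2)) P := by
  refine Integrable.mono' (integrable_finsetSum Finset.univ fun i _ =>
    (M.integrable_log_p hP i).norm)
    (Real.measurable_log.comp (M.measurable_p_selector hs)).aestronglyMeasurable
    (Eventually.of_forall fun l => ?_)
  exact Finset.single_le_sum (f := fun i => ‖Real.log (M.p i l.2)‖) (fun _ _ => norm_nonneg _)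
    (Finset.mem_univ (s l))

lemma log_a_le (i : Fin K) (u : 𝒜) : Real.log (M.a i u) ≤ Real.log M.B :=
  Real.log_le_log (M.a_pos i u) (M.a_le_B i u)

lemma log_B_neg : Real.log M.B < 0 := Real.log_neg M.B_pos M.B_lt_one

section ProbabilityMeasure

variable (P : Measure (𝒜 × 𝒲)) [IsProbabilityMeasure P]

lemma integrable_log_a_selector {s : 𝒜 × 𝒲 → Fin K} (hs : Measurable s) :
    Integrable (fun l => Real.log (M.a (s l) l.1)) P := by
  refine Integrable.of_bound
    (Real.measurable_log.comp (M.measurable_a_selector hs)).aestronglyMeasurable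
    (-Real.log M.A) (Eventually.of_forall fun l => ?_)
  rw [Real.norm_eq_abs, abs_of_nonpos ((M.log_a_le _ _).trans M.log_B_neg.le)]
  exact neg_le_neg (Real.log_le_log M.A_pos (M.A_le_a _ _))

lemma integral_log_a_selector_neg {s : 𝒜 × 𝒲 → Fin K} (hs : Measurable s) :
    ∫ l, Real.log (M.a (s l) l.1) ∂P < 0 := by
  refine lt_of_le_of_lt (integral_mono (M.integrable_log_a_selector P hs)
    (integrable_const (Real.log M.B)) fun l => M.log_a_le _ _) ?_
  simpa using M.log_B_neg

/-- Almost surely, the local dimension at the point with address `s (ω 0), s (ω 1), …` bounds all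
upper `Φ`-dimensions from below and all lower ones from above. -/
lemma ae_ratio_le_upperPhiDim_and (hP : M.HasNegativeMoment P) {s : 𝒜 × 𝒲 → Fin K}
    (hs : Measurable s) :
    ∀ᵐ ω ∂(Measure.infinitePi fun _ : ℕ => P), ∀ Φ : ℝ → ℝ, IsDimensionFunction Φ →
      (((∫ l, Real.log (M.p (s l) l.2) ∂P) / ∫ l, Real.log (M.a (s l) l.1) ∂P : ℝ) : EReal) ≤
          upperPhiDim Φ (M.randomMeasure ω) ∧
        lowerPhiDim Φ (M.randomMeasure ω) ≤
          (((∫ l, Real.log (M.p (s l) l.2) ∂P) /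
            ∫ l, Real.log (M.a (s l) l.1) ∂P : ℝ) : EReal) := by
  have hpos : ∀ᵐ ω ∂(Measure.infinitePi fun _ : ℕ => P), ∀ k : ℕ, ∀ i, 0 < M.p i (ω k).2 :=
    ae_all_iff.2 fun k => (measurePreserving_eval_infinitePi (fun _ : ℕ => P)
      k).quasiMeasurePreserving.ae (M.ae_p_pos hP)
  filter_upwards [hpos,
    ae_tendsto_average_infinitePi P (Real.measurable_log.comp (M.measurable_p_selector hs))
      (M.integrable_log_p_selector hP hs),
    ae_tendsto_average_infinitePi P (Real.measurable_log.comp (M.measurable_a_selector hs))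
      (M.integrable_log_a_selector P hs)] with ω hω hlogp hloga Φ hΦ
  have hv := M.integral_log_a_selector_neg P hs
  constructor
  · refine le_sInf ?_
    rintro _ ⟨d, hd, rfl⟩
    exact EReal.coe_le_coe_iff.2 (M.ratio_le_of_isUpperPhiExponent (ι := fun k => s (ω k))
      (fun k => hω k _) hv hlogp hloga hΦ hd)
  · refine sSup_le ?_
    rintro _ ⟨d, hd, rfl⟩
    exact EReal.coe_le_coe_iff.2 (M.le_ratio_of_isLowerPhiExponent (ι := fun k => s (ω k))
      (fun k => hω k _) hv hlogp hloga hΦ hd)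

/-! ### The Moran dimension -/

lemma sum_rpow_pos (D : ℝ) (u : 𝒜) : 0 < ∑ i, M.a i u ^ D :=
  Finset.sum_pos (fun i _ => Real.rpow_pos_of_pos (M.a_pos i u) D)
    ⟨⟨0, M.K_pos⟩, Finset.mem_univ _⟩

lemma measurable_log_sum_rpow (D : ℝ) :
    Measurable fun l : 𝒜 × 𝒲 => Real.log (∑ i, M.a i l.1 ^ D) :=
  Real.measurable_log.comp (Finset.measurable_sum _ fun i _ =>
    ((M.measurable_a i).comp measurable_fst).pow_const D)

/-- `A ^ D ≤ ∑ i, a i ^ D ≤ K` for `D ≥ 0`, in logarithmic form. -/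
lemma abs_log_sum_rpow_le {D : ℝ} (hD : 0 ≤ D) (u : 𝒜) :
    |Real.log (∑ i, M.a i u ^ D)| ≤ Real.log K - D * Real.log M.A := by
  have hA : Real.log M.A < 0 :=
    (Real.log_le_log M.A_pos (M.A_le_a ⟨0, M.K_pos⟩ u)).trans_lt
      ((M.log_a_le _ _).trans_lt M.log_B_neg)
  have hDA : D * Real.log M.A ≤ 0 := mul_nonpos_of_nonneg_of_nonpos hD hA.le
  have hK : 0 ≤ Real.log K := Real.log_natCast_nonneg K
  have hup : Real.log (∑ i, M.a i u ^ D) ≤ Real.log K := by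
    refine Real.log_le_log (M.sum_rpow_pos D u) ?_
    simpa using Finset.sum_le_card_nsmul Finset.univ (fun i => M.a i u ^ D) 1 fun i _ =>
      Real.rpow_le_one (M.a_pos i u).le ((M.a_le_B i u).trans M.B_lt_one.le) hD
  have hlow : D * Real.log M.A ≤ Real.log (∑ i, M.a i u ^ D) := by
    rw [← Real.log_rpow M.A_pos]
    refine Real.log_le_log (Real.rpow_pos_of_pos M.A_pos D) ?_
    exact (Real.rpow_le_rpow M.A_pos.le (M.A_le_a ⟨0, M.K_pos⟩ u) hD).trans
      (Finset.single_le_sum (f := fun i => M.a i u ^ D)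
        (fun i _ => (Real.rpow_pos_of_pos (M.a_pos i u) D).le) (Finset.mem_univ _))
  rw [abs_le]
  constructor <;> linarith

lemma integrable_log_sum_rpow {D : ℝ} (hD : 0 ≤ D) :
    Integrable (fun l : 𝒜 × 𝒲 => Real.log (∑ i, M.a i l.1 ^ D)) P :=
  Integrable.of_bound (M.measurable_log_sum_rpow D).aestronglyMeasurable _
    (Eventually.of_forall fun l => M.abs_log_sum_rpow_le hD l.1)

/-- The pressure `E (log ∑ i, a i ^ D)` decreases in `D` at rate at least `-log B > 0`. -/
lemma integral_log_sum_rpow_lt {D E : ℝ} (hD : 0 ≤ D) (hDE : D < E) :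
    ∫ l, Real.log (∑ i, M.a i l.1 ^ E) ∂P < ∫ l, Real.log (∑ i, M.a i l.1 ^ D) ∂P := by
  have hpt : ∀ l : 𝒜 × 𝒲, Real.log (∑ i, M.a i l.1 ^ E) ≤
      Real.log (∑ i, M.a i l.1 ^ D) + (E - D) * Real.log M.B := by
    intro l
    rw [← Real.log_rpow M.B_pos, ← Real.log_mul (M.sum_rpow_pos D l.1).ne'
      (Real.rpow_pos_of_pos M.B_pos _).ne']
    refine Real.log_le_log (M.sum_rpow_pos E l.1) ?_
    rw [Finset.sum_mul]
    refine Finset.sum_le_sum fun i _ => ?_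
    calc M.a i l.1 ^ E = M.a i l.1 ^ D * M.a i l.1 ^ (E - D) := by
          rw [← Real.rpow_add (M.a_pos _ _)]; congr 1; ring
      _ ≤ M.a i l.1 ^ D * M.B ^ (E - D) :=
          mul_le_mul_of_nonneg_left (Real.rpow_le_rpow (M.a_pos _ _).le (M.a_le_B _ _)
            (sub_nonneg.2 hDE.le)) (Real.rpow_pos_of_pos (M.a_pos _ _) _).le
  have h := integral_mono (M.integrable_log_sum_rpow P (hD.trans hDE.le))
    ((M.integrable_log_sum_rpow P hD).add (integrable_const _)) hpt
  simp only [Pi.add_apply] at h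
  rw [integral_add (M.integrable_log_sum_rpow P hD) (integrable_const _)] at h
  simp only [integral_const, probReal_univ, one_smul] at h
  have := mul_neg_of_pos_of_neg (sub_pos.2 hDE) M.log_B_neg
  linarith

lemma continuousOn_integral_log_sum_rpow :
    ContinuousOn (fun D : ℝ => ∫ l, Real.log (∑ i, M.a i l.1 ^ D) ∂P) (Icc 0 1) := by
  have hA : Real.log M.A ≤ 0 := by
    refine Real.log_nonpos M.A_pos.le ?_
    obtain ⟨l⟩ : Nonempty (𝒜 × 𝒲) := P.nonempty_of_neZero
    exact (M.A_le_a ⟨0, M.K_pos⟩ l.1).trans ((M.a_le_B _ _).trans M.B_lt_one.le)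
  refine continuousOn_of_dominated (bound := fun _ => Real.log K - Real.log M.A)
    (fun D _ => (M.measurable_log_sum_rpow D).aestronglyMeasurable) ?_ (integrable_const _) ?_
  · intro D hD
    refine Eventually.of_forall fun l => (M.abs_log_sum_rpow_le hD.1 l.1).trans ?_
    have := mul_le_mul_of_nonpos_right hD.2 hA
    linarith
  · refine Eventually.of_forall fun l => Continuous.continuousOn ?_
    refine Continuous.log (continuous_finsetSum _ fun i _ => ?_)
      fun D => (M.sum_rpow_pos D l.1).ne'
    exact Real.continuous_const_rpow (M.a_pos i l.1).ne'

theorem existsUnique_isMoranDimension : ∃! D : ℝ, M.IsMoranDimension P D := by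
  have h0 : 0 ≤ ∫ l, Real.log (∑ i, M.a i l.1 ^ (0 : ℝ)) ∂P := by
    simpa using Real.log_natCast_nonneg K
  have h1 : ∫ l, Real.log (∑ i, M.a i l.1 ^ (1 : ℝ)) ∂P ≤ 0 := by
    refine integral_nonpos fun l => Real.log_nonpos (M.sum_rpow_pos 1 l.1).le ?_
    simpa using (M.sum_a_le l.1).trans M.B_lt_one.le
  obtain ⟨D, hD, hD0⟩ := intermediate_value_Icc' zero_le_one
    (M.continuousOn_integral_log_sum_rpow P) ⟨h1, h0⟩
  refine ⟨D, ⟨hD.1, hD0⟩, fun E hE => ?_⟩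
  rcases lt_trichotomy E D with h | h | h
  · have := M.integral_log_sum_rpow_lt P hE.1 h
    rw [hE.2] at this
    exact absurd hD0 this.ne
  · exact h
  · have := M.integral_log_sum_rpow_lt P hD.1 h
    rw [hE.2] at this
    exact absurd hD0 this.ne'

end ProbabilityMeasure

/-! ### Comparison with the natural weights -/

lemma naturalWeight_pos (D : ℝ) (l : 𝒜 × 𝒲) (i : Fin K) : 0 < M.naturalWeight D l i :=
  div_pos (Real.rpow_pos_of_pos (M.a_pos _ _) _) (M.sum_rpow_pos D l.1)

lemma sum_naturalWeight (D : ℝ) (l : 𝒜 × 𝒲) : ∑ i, M.naturalWeight D l i = 1 := by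
  simp only [naturalWeight, ← Finset.sum_div]
  exact div_self (M.sum_rpow_pos D l.1).ne'

lemma log_naturalWeight (D : ℝ) (l : 𝒜 × 𝒲) (i : Fin K) :
    Real.log (M.naturalWeight D l i) =
      D * Real.log (M.a i l.1) - Real.log (∑ j, M.a j l.1 ^ D) := by
  rw [naturalWeight, Real.log_div (Real.rpow_pos_of_pos (M.a_pos _ _) _).ne'
    (M.sum_rpow_pos D l.1).ne', Real.log_rpow (M.a_pos _ _)]

lemma measurable_m (D : ℝ) : Measurable (M.m D) :=
  measurable_minArgmax M.K_pos fun j => (((M.measurable_a j).comp measurable_fst).pow_const D).div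
    ((M.measurable_p j).comp measurable_snd)

lemma measurable_m' (D : ℝ) : Measurable (M.m' D) := by
  unfold m'
  simp only [minArgmin_eq_minArgmax_neg]
  exact measurable_minArgmax M.K_pos fun j =>
    ((((M.measurable_a j).comp measurable_fst).pow_const D).div
      ((M.measurable_p j).comp measurable_snd)).neg

lemma naturalWeight_div (D : ℝ) (l : 𝒜 × 𝒲) (j : Fin K) :
    M.naturalWeight D l j / M.p j l.2 =
      M.a j l.1 ^ D / M.p j l.2 / ∑ i, M.a i l.1 ^ D := by
  rw [naturalWeight, div_right_comm]

lemma p_m_le_naturalWeight (D : ℝ) {l : 𝒜 × 𝒲} (hl : ∀ i, 0 < M.p i l.2) :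
    M.p (M.m D l) l.2 ≤ M.naturalWeight D l (M.m D l) := by
  refine le_of_forall_div_le_div (p := fun i => M.p i l.2) hl
    ((M.sum_p _).trans (M.sum_naturalWeight D l).symm) fun j => ?_
  rw [naturalWeight_div, naturalWeight_div]
  exact div_le_div_of_nonneg_right (le_minArgmax M.K_pos
    (fun j => M.a j l.1 ^ D / M.p j l.2) j) (M.sum_rpow_pos D l.1).le

lemma naturalWeight_le_p_m' (D : ℝ) {l : 𝒜 × 𝒲} (hl : ∀ i, 0 < M.p i l.2) :
    M.naturalWeight D l (M.m' D l) ≤ M.p (M.m' D l) l.2 := by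
  refine le_of_forall_div_ge_div (p := fun i => M.p i l.2) hl
    ((M.sum_p _).trans (M.sum_naturalWeight D l).symm) fun j => ?_
  rw [naturalWeight_div, naturalWeight_div]
  exact div_le_div_of_nonneg_right (minArgmin_le M.K_pos
    (fun j => M.a j l.1 ^ D / M.p j l.2) j) (M.sum_rpow_pos D l.1).le

lemma ae_log_sub_eq_zero_iff {P : Measure (𝒜 × 𝒲)} (hP : M.HasNegativeMoment P) (D : ℝ)
    (s : 𝒜 × 𝒲 → Fin K) :
    (∀ᵐ l ∂P, Real.log (M.p (s l) l.2) - Real.log (M.naturalWeight D l (s l)) = 0) ↔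
      ∀ᵐ l ∂P, M.p (s l) l.2 = M.naturalWeight D l (s l) := by
  refine eventually_congr ?_
  filter_upwards [M.ae_p_pos hP] with l hl
  rw [sub_eq_zero]
  exact Real.log_injOn_pos.eq_iff (hl _) (M.naturalWeight_pos D l _)

variable {P : Measure (𝒜 × 𝒲)} [IsProbabilityMeasure P]

lemma integrable_log_p_sub_log_naturalWeight (hP : M.HasNegativeMoment P) {D : ℝ} (hD : 0 ≤ D)
    {s : 𝒜 × 𝒲 → Fin K} (hs : Measurable s) :
    Integrable (fun l => Real.log (M.p (s l) l.2) - Real.log (M.naturalWeight D l (s l))) P := by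
  simp only [log_naturalWeight]
  exact (M.integrable_log_p_selector hP hs).sub
    (((M.integrable_log_a_selector P hs).const_mul D).sub (M.integrable_log_sum_rpow P hD))

/-- The gap between the local dimension along `s` and `D` is measured by the mean of
`log (p / q)` at the selected index, `q` being the natural weights: the normalization of `q` does
not contribute because `E (log ∑ i, a i ^ D) = 0`. -/
lemma ratio_sub_eq (hP : M.HasNegativeMoment P) {D : ℝ} (hD : M.IsMoranDimension P D)
    {s : 𝒜 × 𝒲 → Fin K} (hs : Measurable s) :
    (∫ l, Real.log (M.p (s l) l.2) ∂P) / (∫ l, Real.log (M.a (s l) l.1) ∂P) - D =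
      (∫ l, (Real.log (M.p (s l) l.2) - Real.log (M.naturalWeight D l (s l))) ∂P) /
        ∫ l, Real.log (M.a (s l) l.1) ∂P := by
  have ha := (M.integrable_log_a_selector P hs).const_mul D
  have hS := M.integrable_log_sum_rpow P hD.1
  simp only [log_naturalWeight]
  have h := integral_sub (M.integrable_log_p_selector hP hs) (ha.sub hS)
  simp only [Pi.sub_apply] at h
  rw [h, integral_sub ha hS, hD.2, integral_const_mul, sub_zero, sub_div,
    mul_div_cancel_right₀ _ (M.integral_log_a_selector_neg P hs).ne]

/-- The ratio of expectations along `s` equals `D` exactly when the integral in `ratio_sub_eq`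
vanishes. -/
lemma ratio_eq_iff (hP : M.HasNegativeMoment P) {D : ℝ} (hD : M.IsMoranDimension P D)
    {s : 𝒜 × 𝒲 → Fin K} (hs : Measurable s) :
    (∫ l, Real.log (M.p (s l) l.2) ∂P) / (∫ l, Real.log (M.a (s l) l.1) ∂P) = D ↔
      ∫ l, (Real.log (M.p (s l) l.2) - Real.log (M.naturalWeight D l (s l))) ∂P = 0 := by
  rw [← sub_eq_zero, M.ratio_sub_eq hP hD hs, div_eq_zero_iff,
    or_iff_left (M.integral_log_a_selector_neg P hs).ne]

lemma le_ratio_and_ratio_eq_iff (hP : M.HasNegativeMoment P) {D : ℝ}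
    (hD : M.IsMoranDimension P D) {s : 𝒜 × 𝒲 → Fin K} (hs : Measurable s)
    (h : ∀ᵐ l ∂P, M.p (s l) l.2 ≤ M.naturalWeight D l (s l)) :
    D ≤ (∫ l, Real.log (M.p (s l) l.2) ∂P) / (∫ l, Real.log (M.a (s l) l.1) ∂P) ∧
      ((∫ l, Real.log (M.p (s l) l.2) ∂P) / (∫ l, Real.log (M.a (s l) l.1) ∂P) = D ↔
        ∀ᵐ l ∂P, M.p (s l) l.2 = M.naturalWeight D l (s l)) := by
  have hle : (fun l => Real.log (M.p (s l) l.2) - Real.log (M.naturalWeight D l (s l)))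
      ≤ᵐ[P] 0 := by
    filter_upwards [h, M.ae_p_pos hP] with l hl hp
    exact sub_nonpos.2 (Real.log_le_log (hp _) hl)
  constructor
  · rw [← sub_nonneg, M.ratio_sub_eq hP hD hs]
    exact div_nonneg_of_nonpos (integral_nonpos_of_ae hle)
      (M.integral_log_a_selector_neg P hs).le
  · rw [M.ratio_eq_iff hP hD hs, ← M.ae_log_sub_eq_zero_iff hP, ← neg_eq_zero,
      ← integral_neg, integral_eq_zero_iff_of_nonneg_ae
        (hle.mono fun l hl => neg_nonneg.2 hl)
        (M.integrable_log_p_sub_log_naturalWeight hP hD.1 hs).neg]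
    exact eventually_congr (Eventually.of_forall fun l => neg_eq_zero)

lemma ratio_le_and_ratio_eq_iff (hP : M.HasNegativeMoment P) {D : ℝ}
    (hD : M.IsMoranDimension P D) {s : 𝒜 × 𝒲 → Fin K} (hs : Measurable s)
    (h : ∀ᵐ l ∂P, M.naturalWeight D l (s l) ≤ M.p (s l) l.2) :
    (∫ l, Real.log (M.p (s l) l.2) ∂P) / (∫ l, Real.log (M.a (s l) l.1) ∂P) ≤ D ∧
      ((∫ l, Real.log (M.p (s l) l.2) ∂P) / (∫ l, Real.log (M.a (s l) l.1) ∂P) = D ↔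
        ∀ᵐ l ∂P, M.p (s l) l.2 = M.naturalWeight D l (s l)) := by
  have hge : 0 ≤ᵐ[P]
      fun l => Real.log (M.p (s l) l.2) - Real.log (M.naturalWeight D l (s l)) := by
    filter_upwards [h] with l hl
    exact sub_nonneg.2 (Real.log_le_log (M.naturalWeight_pos D l _) hl)
  constructor
  · rw [← sub_nonpos, M.ratio_sub_eq hP hD hs]
    exact div_nonpos_of_nonneg_of_nonpos (integral_nonneg_of_ae hge)
      (M.integral_log_a_selector_neg P hs).le
  · rw [M.ratio_eq_iff hP hD hs, ← M.ae_log_sub_eq_zero_iff hP]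
    exact integral_eq_zero_iff_of_nonneg_ae hge
      (M.integrable_log_p_sub_log_naturalWeight hP hD.1 hs)

end MoranModel

/-! ### Dimensions at the extremal addresses -/

theorem mainTheorem9 {K : ℕ} {𝒜 𝒲 : Type*} [MeasurableSpace 𝒜] [MeasurableSpace 𝒲]
    (M : MoranModel K 𝒜 𝒲) (P : Measure (𝒜 × 𝒲)) [IsProbabilityMeasure P]
    (hP : M.HasNegativeMoment P) :
    (∃! D : ℝ, M.IsMoranDimension P D) ∧
    ∀ D : ℝ, M.IsMoranDimension P D →
      -- the upper dimension
      (D ≤ M.G P D ∧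
        (∀ᵐ ω ∂(Measure.infinitePi fun _ : ℕ => P), ∀ Φ : ℝ → ℝ, IsLargeDimensionFunction Φ →
          (D : EReal) ≤ upperPhiDim Φ (M.randomMeasure ω)) ∧
        (M.G P D = D ↔
          ∀ᵐ l ∂P, M.p (M.m D l) l.2 = M.naturalWeight D l (M.m D l)) ∧
        (D < M.G P D →
          ∀ᵐ ω ∂(Measure.infinitePi fun _ : ℕ => P), ∀ Φ : ℝ → ℝ, IsLargeDimensionFunction Φ →
            (D : EReal) < upperPhiDim Φ (M.randomMeasure ω))) ∧
      -- the lower dimension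
      (M.G' P D ≤ D ∧
        (∀ᵐ ω ∂(Measure.infinitePi fun _ : ℕ => P), ∀ Φ : ℝ → ℝ, IsLargeDimensionFunction Φ →
          lowerPhiDim Φ (M.randomMeasure ω) ≤ (D : EReal)) ∧
        (M.G' P D = D ↔
          ∀ᵐ l ∂P, M.p (M.m' D l) l.2 = M.naturalWeight D l (M.m' D l)) ∧
        (M.G' P D < D →
          ∀ᵐ ω ∂(Measure.infinitePi fun _ : ℕ => P), ∀ Φ : ℝ → ℝ, IsLargeDimensionFunction Φ →
            lowerPhiDim Φ (M.randomMeasure ω) < (D : EReal))) := by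
  refine ⟨M.existsUnique_isMoranDimension P, fun D hD => ?_⟩
  have hpos := M.ae_p_pos hP
  obtain ⟨hG, hGeq⟩ := M.le_ratio_and_ratio_eq_iff hP hD (M.measurable_m D)
    (hpos.mono fun l hl => M.p_m_le_naturalWeight D hl)
  obtain ⟨hG', hGeq'⟩ := M.ratio_le_and_ratio_eq_iff hP hD (M.measurable_m' D)
    (hpos.mono fun l hl => M.naturalWeight_le_p_m' D hl)
  have hdim := M.ae_ratio_le_upperPhiDim_and P hP (M.measurable_m D)
  have hdim' := M.ae_ratio_le_upperPhiDim_and P hP (M.measurable_m' D)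
  exact ⟨⟨hG,
    hdim.mono fun ω h Φ hΦ => (EReal.coe_le_coe_iff.2 hG).trans (h Φ hΦ.1).1, hGeq,
    fun hlt => hdim.mono fun ω h Φ hΦ => (EReal.coe_lt_coe_iff.2 hlt).trans_le (h Φ hΦ.1).1⟩,
    hG', hdim'.mono fun ω h Φ hΦ => (h Φ hΦ.1).2.trans (EReal.coe_le_coe_iff.2 hG'), hGeq',
    fun hlt => hdim'.mono fun ω h Φ hΦ => (h Φ hΦ.1).2.trans_lt (EReal.coe_lt_coe_iff.2 hlt)⟩
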